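/- For $a\in\mathbb R$ and $n\ge 0$ let $k^{-a}(n)$ denote the $n$-th Taylor coefficient at the origin of the function $(1-t)^a$. Let $H$ be a complex Hilbert space and $T$ a bounded linear operator on $H$. For $a>0$, $T$ is called an \emph{$a$-contraction} if the series $\sum_{n=0}^\infty k^{-a}(n)\,T^{*n}T^n$ converges in the strong operator topology (SOT) of $L(H)$ and its sum is a positive semidefinite operator. \textbf{Theorem.} Let $0<b<a$, where $b$ is not an integer. If $T$ is an $a$-contraction and the series $\sum_{n=0}^\infty |k^{-b}(n)|\,T^{*n}T^n$ converges in SOT, then $T$ is a $b$-contraction. -/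

import Mathlib

open Filter Topology
open scoped Nat

noncomputable section

/-- The Cesàro number `k^a(n)`: the `n`-th Taylor coefficient at the origin of `(1 - t)^(-a)`.
Thus `cesaroNumber (-a) n` is the `n`-th Taylor coefficient of `(1 - t)^a`. -/
def cesaroNumber (a : ℝ) (n : ℕ) : ℝ :=
  iteratedDeriv n (fun t : ℝ => (1 - t) ^ (-a)) 0 / (n ! : ℝ)

section Hereditary

variable {H : Type*} [NormedAddCommGroup H] [InnerProductSpace ℂ H] [CompleteSpace H]

/-- The partial sum `∑_{n < N} α_n T^{*n} T^n`. -/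
def hereditaryPartialSum (α : ℕ → ℝ) (T : H →L[ℂ] H) (N : ℕ) : H →L[ℂ] H :=
  ∑ n ∈ Finset.range N, (α n : ℂ) • (ContinuousLinearMap.adjoint T ^ n * T ^ n)

/-- The series `∑ α_n T^{*n} T^n` converges to `S` in the strong operator topology, which is the
topology of `H →Lₚₜ[ℂ] H` (pointwise convergence of bounded operators). -/
def HasHereditarySum (α : ℕ → ℝ) (T S : H →L[ℂ] H) : Prop :=
  Tendsto
    (fun N => ContinuousLinearMap.toPointwiseConvergenceCLM ℂ (RingHom.id ℂ) H H
      (hereditaryPartialSum α T N))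
    atTop (𝓝 (ContinuousLinearMap.toPointwiseConvergenceCLM ℂ (RingHom.id ℂ) H H S))

/-- The series `∑ |α_n| T^{*n} T^n` converges in the strong operator topology of `L(H)`. -/
def AbsHereditarySummable (α : ℕ → ℝ) (T : H →L[ℂ] H) : Prop :=
  ∃ S : H →L[ℂ] H, HasHereditarySum (fun n => |α n|) T S

/-- `T` is an `a`-contraction: the series `∑ k^{-a}(n) T^{*n} T^n` converges in the strong
operator topology and its sum `(1 - t)^a(T^*, T)` is a positive (semidefinite) operator. -/
def IsRealContraction (a : ℝ) (T : H →L[ℂ] H) : Prop :=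
  ∃ S : H →L[ℂ] H, HasHereditarySum (cesaroNumber (-a)) T S ∧ S.IsPositive

end Hereditary

end

/-! Fix `x` and put `u n = ‖T ^ n x‖ ^ 2`. Formally `(1 - t) ^ b = (1 - t) ^ a * (1 - t) ^ (-(a -
b))`, and the last factor has nonnegative coefficients. So the quadratic form of the `b`-sum at `x`
is a nonnegative combination of the values of the `a`-form at the vectors `T ^ j x`.

The rearrangement need not converge absolutely. It is therefore done with `(1 - r t) ^ (-(a - b))`,
`0 < r < 1` (`tsum_coeff_mul_nonneg`), and then `r → 1`. Since `b` is not an integer, the hypothesis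
makes `u` summable against `(n + 1) ^ (-b - 1)`. Dominated convergence then needs only that the
coefficients of `(1 - t) ^ a * (1 - r t) ^ (-(a - b))` are `O((n + 1) ^ (-b - 1))` uniformly in `r`
(`uniformCoeffBound`). -/

/-- The formal power series of `(1 - r t) ^ s`. -/
noncomputable def oneSubPow (r s : ℝ) : PowerSeries ℝ :=
  PowerSeries.rescale (-r) (PowerSeries.binomialSeries ℝ s)

/-- The `n`-th coefficient of `(1 - t) ^ s`. -/
noncomputable def oneSubCoeff (s : ℝ) (n : ℕ) : ℝ := (-1) ^ n * Ring.choose s n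

theorem coeff_oneSubPow (r s : ℝ) (n : ℕ) :
    PowerSeries.coeff n (oneSubPow r s) = r ^ n * oneSubCoeff s n := by
  simp only [oneSubPow, PowerSeries.coeff_rescale, PowerSeries.binomialSeries_coeff,
    oneSubCoeff, neg_pow r n, smul_eq_mul]
  ring

theorem oneSubPow_add (r s t : ℝ) : oneSubPow r (s + t) = oneSubPow r s * oneSubPow r t := by
  simp [oneSubPow]

@[simp]
theorem oneSubCoeff_zero (s : ℝ) : oneSubCoeff s 0 = 1 := by simp [oneSubCoeff]

theorem factorial_mul_choose (s : ℝ) (n : ℕ) :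
    (n ! : ℝ) * Ring.choose s n = (descPochhammer ℝ n).eval s := by
  have h := Ring.descPochhammer_eq_factorial_smul_choose s n
  rw [nsmul_eq_mul] at h
  rw [← h, ← descPochhammer_map (Int.castRingHom ℝ), ← Polynomial.aeval_eq_smeval,
    Polynomial.aeval_def, Polynomial.eval_map]
  rfl

theorem oneSubCoeff_succ (s : ℝ) (n : ℕ) :
    (n + 1 : ℝ) * oneSubCoeff s (n + 1) = (n - s) * oneSubCoeff s n := by
  have h1 := factorial_mul_choose s n
  have h2 := factorial_mul_choose s (n + 1)
  rw [descPochhammer_succ_eval, ← h1, Nat.factorial_succ] at h2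
  push_cast at h2
  have h3 : (n ! : ℝ) ≠ 0 := by positivity
  have h4 : (n + 1 : ℝ) * Ring.choose s (n + 1) = (s - n) * Ring.choose s n := by
    apply mul_left_cancel₀ h3
    linear_combination h2
  simp only [oneSubCoeff, pow_succ]
  linear_combination (-(-1) ^ n) * h4

theorem oneSubCoeff_succ_sub_one (s : ℝ) (n : ℕ) :
    (n + 1 : ℝ) * oneSubCoeff s (n + 1) = -s * oneSubCoeff (s - 1) n := by
  induction n with
  | zero => have := oneSubCoeff_succ s 0; simp at this ⊢; linarith
  | succ n ih =>
    have h1 := oneSubCoeff_succ s (n + 1)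
    have h2 := oneSubCoeff_succ (s - 1) n
    have h0 : (n + 1 : ℝ) ≠ 0 := by positivity
    push_cast at h1 ⊢
    apply mul_left_cancel₀ h0
    linear_combination (n + 1 : ℝ) * h1 + (n + 1 - s) * ih + s * h2

theorem cesaroNumber_neg (s : ℝ) (n : ℕ) : cesaroNumber (-s) n = oneSubCoeff s n := by
  have h : iteratedDeriv n (fun t : ℝ => (1 - t) ^ s) 0
      = (-1) ^ n * (descPochhammer ℝ n).eval s := by
    have := congrFun (iteratedDeriv_comp_const_sub (n := n) (f := fun t : ℝ => t ^ s) (s := 1)) 0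
    simp only [sub_zero, smul_eq_mul] at this
    rw [this, iteratedDeriv_eq_iterate, Real.iter_deriv_rpow_const]
    simp
  rw [cesaroNumber, neg_neg, h, ← factorial_mul_choose, oneSubCoeff]
  field_simp

theorem oneSubCoeff_nonneg {s : ℝ} (hs : s ≤ 0) (n : ℕ) : 0 ≤ oneSubCoeff s n := by
  induction n with
  | zero => simp
  | succ n ih =>
    have h := oneSubCoeff_succ s n
    have : 0 ≤ (n + 1 : ℝ) * oneSubCoeff s (n + 1) := by
      rw [h]; exact mul_nonneg (by have : (0:ℝ) ≤ n := n.cast_nonneg; linarith) ih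
    exact nonneg_of_mul_nonneg_right this (by positivity)

theorem derivative_oneSubPow (r s : ℝ) :
    PowerSeries.derivative (R := ℝ) (oneSubPow r s) = (-s * r) • oneSubPow r (s - 1) := by
  ext n
  rw [PowerSeries.coeff_derivative, PowerSeries.coeff_smul, coeff_oneSubPow, coeff_oneSubPow,
    smul_eq_mul]
  linear_combination r ^ (n + 1) * oneSubCoeff_succ_sub_one s n

theorem oneSubPow_one (r : ℝ) : oneSubPow r 1 = 1 - PowerSeries.C r * PowerSeries.X := by
  have := PowerSeries.binomialSeries_nat (R := ℝ) (A := ℝ) 1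
  simp only [Nat.cast_one, pow_one] at this
  rw [oneSubPow, this]
  simp [PowerSeries.rescale_X, sub_eq_add_neg]

/-! ### Power-law size of the coefficients -/

/-- Up to constants, the coefficients of `(1 - t) ^ s` have size `n ^ (-s - 1)`. -/
theorem tendsto_rpow_div_oneSubCoeff (s : ℝ) :
    Tendsto (fun n : ℕ => (n : ℝ) ^ (-s) / ((n + 1) * oneSubCoeff s (n + 1))) atTop
      (𝓝 (Real.Gamma (-s))) := by
  refine (Real.GammaSeq_tendsto_Gamma (-s)).congr fun n => ?_
  have h : ∀ m : ℕ, (∏ j ∈ Finset.range m, (-s + j)) = m ! * oneSubCoeff s m := by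
    intro m
    induction m with
    | zero => simp
    | succ m ih =>
      rw [Finset.prod_range_succ, ih, Nat.factorial_succ]
      push_cast
      linear_combination (-(m ! : ℝ)) * oneSubCoeff_succ s m
  rw [Real.GammaSeq, h, Nat.factorial_succ]
  push_cast
  have : (n ! : ℝ) ≠ 0 := by positivity
  rw [show ((n : ℝ) + 1) * (n ! : ℝ) * oneSubCoeff s (n + 1) = ((n + 1) * oneSubCoeff s (n + 1)) * (n ! : ℝ) by
    ring, mul_div_mul_right _ _ this]

theorem exists_oneSubCoeff_neg_le {δ : ℝ} (hδ : 1 ≤ δ) :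
    ∃ C : ℝ, ∀ n : ℕ, oneSubCoeff (-δ) n ≤ C * (n + 1 : ℝ) ^ (δ - 1) := by
  have hG : 0 < Real.Gamma δ := Real.Gamma_pos_of_pos (by linarith)
  have h := (tendsto_rpow_div_oneSubCoeff (-δ)).inv₀ (by rw [neg_neg]; exact hG.ne')
  obtain ⟨M, hM⟩ := h.bddAbove_range
  have hM' : ∀ n : ℕ, ((n : ℝ) ^ (- -δ) / ((n + 1) * oneSubCoeff (-δ) (n + 1)))⁻¹ ≤ M :=
    fun n => hM ⟨n, rfl⟩
  refine ⟨max M (max 1 δ), fun n => ?_⟩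
  have hC0 : (0 : ℝ) ≤ max M (max 1 δ) := le_trans zero_le_one (by simp)
  have hone : ∀ n : ℕ, (1 : ℝ) ≤ (n + 1 : ℝ) ^ (δ - 1) := fun n =>
    Real.one_le_rpow (by simp) (by linarith)
  -- The limit at index `n` controls coefficient `n + 1`, and at `n = 0` the ratio is the
  -- uninformative `0`; hence coefficients 0 and 1 are treated apart.
  match n with
  | 0 =>
    rw [oneSubCoeff_zero]
    calc (1 : ℝ) = 1 * 1 := by ring
      _ ≤ _ := mul_le_mul (by simp) (hone 0) zero_le_one hC0
  | 1 =>
    have h1 := oneSubCoeff_succ (-δ) 0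
    simp only [Nat.cast_zero, zero_add, one_mul, sub_neg_eq_add, oneSubCoeff_zero, mul_one] at h1
    rw [h1]
    calc δ = δ * 1 := by ring
      _ ≤ _ := mul_le_mul (by simp) (hone 1) zero_le_one hC0
  | n + 2 =>
    have h1 := hM' (n + 1)
    have hn : (0 : ℝ) < (n + 1 : ℕ) := by positivity
    rw [inv_div, neg_neg, div_le_iff₀ (by positivity)] at h1
    have h2 : ((n + 1 : ℕ) : ℝ) ^ δ ≤ ((n + 1 : ℕ) + 1) * ((n + 2 : ℕ) + 1 : ℝ) ^ (δ - 1) := by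
      rw [show δ = (δ - 1) + 1 by ring, Real.rpow_add_one hn.ne', mul_comm, add_sub_cancel_right]
      gcongr
      · linarith
      · push_cast; linarith
    have hp : (0 : ℝ) < (n + 1 : ℕ) + 1 := by positivity
    refine le_of_mul_le_mul_left ?_ hp
    calc ((n + 1 : ℕ) + 1 : ℝ) * oneSubCoeff (-δ) (n + 2) ≤ M * ((n + 1 : ℕ) : ℝ) ^ δ := h1
      _ ≤ max M (max 1 δ) * (((n + 1 : ℕ) + 1) * ((n + 2 : ℕ) + 1 : ℝ) ^ (δ - 1)) := by
        gcongr
        exact le_max_left _ _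
      _ = _ := by ring

theorem oneSubCoeff_ne_zero {b : ℝ} (hb : ∀ m : ℤ, b ≠ (m : ℝ)) (n : ℕ) :
    oneSubCoeff b n ≠ 0 := by
  induction n with
  | zero => simp
  | succ n ih =>
    have h := oneSubCoeff_succ b n
    have h1 : (n : ℝ) - b ≠ 0 := fun h0 => hb n (by push_cast; linarith)
    exact right_ne_zero_of_mul (h ▸ mul_ne_zero h1 ih)

/-- Non-integrality is essential here: for a positive integer `b` the coefficients vanish beyond
index `b`. -/
theorem exists_rpow_le_mul_abs_oneSubCoeff {b : ℝ} (hb : 0 < b) (hbint : ∀ m : ℤ, b ≠ (m : ℝ)) :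
    ∃ C : ℝ, ∀ n : ℕ, (n + 1 : ℝ) ^ (-b - 1) ≤ C * |oneSubCoeff b n| := by
  obtain ⟨M, hM⟩ := (tendsto_rpow_div_oneSubCoeff b).abs.bddAbove_range
  have hM' : ∀ n : ℕ, |(n : ℝ) ^ (-b) / ((n + 1) * oneSubCoeff b (n + 1))| ≤ M :=
    fun n => hM ⟨n, rfl⟩
  have hone : ∀ n : ℕ, (n + 1 : ℝ) ^ (-b - 1) ≤ 1 := fun n =>
    Real.rpow_le_one_of_one_le_of_nonpos (by simp) (by linarith)
  refine ⟨max M (max 1 b⁻¹), fun n => ?_⟩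
  match n with
  | 0 => simp
  | 1 =>
    have h1 := oneSubCoeff_succ b 0
    simp only [Nat.cast_zero, zero_add, one_mul, zero_sub, oneSubCoeff_zero, mul_one] at h1
    rw [h1, abs_neg, abs_of_pos hb]
    calc _ ≤ (1 : ℝ) := hone 1
      _ = b⁻¹ * b := by field_simp
      _ ≤ _ := by gcongr; simp
  | n + 2 =>
    have h1 := hM' (n + 1)
    have hk : 0 < |oneSubCoeff b (n + 2)| := abs_pos.2 (oneSubCoeff_ne_zero hbint _)
    have hn : (0 : ℝ) < (n + 1 : ℕ) := by positivity
    have hp : (0 : ℝ) < (n + 1 : ℕ) + 1 := by positivity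
    rw [abs_div, abs_mul, abs_of_pos hp, div_le_iff₀ (by positivity),
      abs_of_pos (Real.rpow_pos_of_pos hn _)] at h1
    have h2 : ((n + 1 : ℕ) + 1) * ((n + 2 : ℕ) + 1 : ℝ) ^ (-b - 1) ≤ ((n + 1 : ℕ) : ℝ) ^ (-b) := by
      have e : ((n + 2 : ℕ) + 1 : ℝ) ^ (-b) =
          ((n + 2 : ℕ) + 1 : ℝ) ^ (-b - 1) * ((n + 2 : ℕ) + 1 : ℝ) := by
        rw [← Real.rpow_add_one (by positivity), sub_add_cancel]
      have h3 : ((n + 2 : ℕ) + 1 : ℝ) ^ (-b) ≤ ((n + 1 : ℕ) : ℝ) ^ (-b) :=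
        Real.rpow_le_rpow_of_nonpos hn (by push_cast; linarith) (by linarith)
      rw [e] at h3
      refine le_trans ?_ h3
      rw [mul_comm]
      gcongr
      simp
    refine le_of_mul_le_mul_left ?_ hp
    calc _ ≤ _ := h2
      _ ≤ M * (((n + 1 : ℕ) + 1) * |oneSubCoeff b (n + 2)|) := h1
      _ ≤ max M (max 1 b⁻¹) * (((n + 1 : ℕ) + 1) * |oneSubCoeff b (n + 2)|) := by
        gcongr; exact le_max_left _ _
      _ = _ := by ring

/-! ### Coefficient bounds uniform in `r` -/

/-- Multiplication by `(1 - t) / (1 - r t)` at most doubles a monotone coefficient bound. -/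
theorem abs_coeff_mul_oneSubPow_le {r : ℝ} (hr : r ∈ Set.Icc (0 : ℝ) 1) (q : PowerSeries ℝ)
    {B : ℕ → ℝ} (hB : Monotone B) (hq : ∀ n, |PowerSeries.coeff n q| ≤ B n) (n : ℕ) :
    |PowerSeries.coeff n (q * (oneSubPow 1 1 * oneSubPow r (-1)))| ≤ 2 * B n := by
  obtain ⟨hr0, hr1⟩ := hr
  set g := q * oneSubPow r (-1) with hg
  have hgq : g * oneSubPow r 1 = q := by
    rw [hg, mul_assoc, ← oneSubPow_add]
    simp [oneSubPow]
  have hB0 : ∀ n, 0 ≤ B n := fun n => (abs_nonneg _).trans (hq n)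
  have hz : PowerSeries.coeff 0 g = PowerSeries.coeff 0 q := by
    rw [← hgq, oneSubPow_one]; simp
  have hs : ∀ n, PowerSeries.coeff (n + 1) g
      = r * PowerSeries.coeff n g + PowerSeries.coeff (n + 1) q := by
    intro n
    rw [← hgq, oneSubPow_one, mul_sub, mul_one, map_sub,
      show g * (PowerSeries.C r * PowerSeries.X) = PowerSeries.C r * g * PowerSeries.X by ring,
      PowerSeries.coeff_succ_mul_X, PowerSeries.coeff_C_mul]
    ring
  -- The recursion bounds `(1 - r) * |g n|` by a convex combination of values of `B`. The same
  -- factor `1 - r` reappears in the coefficients of `g * (1 - X)`, so nothing blows up as `r → 1`.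
  have hbound : ∀ n, (1 - r) * |PowerSeries.coeff n g| ≤ B n := by
    intro n
    induction n with
    | zero =>
      rw [hz]
      nlinarith [hq 0, abs_nonneg (PowerSeries.coeff 0 q)]
    | succ n ih =>
      rw [hs]
      have h1 := abs_add_le (r * PowerSeries.coeff n g) (PowerSeries.coeff (n + 1) q)
      rw [abs_mul, abs_of_nonneg hr0] at h1
      calc _ ≤ (1 - r) * (r * |PowerSeries.coeff n g| + |PowerSeries.coeff (n + 1) q|) :=
            mul_le_mul_of_nonneg_left h1 (by linarith)
        _ = r * ((1 - r) * |PowerSeries.coeff n g|) + (1 - r) * |PowerSeries.coeff (n + 1) q| := by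
            ring
        _ ≤ r * B (n + 1) + (1 - r) * B (n + 1) :=
            add_le_add (mul_le_mul_of_nonneg_left (ih.trans (hB n.le_succ)) hr0)
              (mul_le_mul_of_nonneg_left (hq _) (by linarith))
        _ = B (n + 1) := by ring
  have hh : q * (oneSubPow 1 1 * oneSubPow r (-1)) = g * (1 - PowerSeries.X) := by
    rw [hg, oneSubPow_one]; simp; ring
  rw [hh]
  cases n with
  | zero =>
    simp only [mul_sub, mul_one, map_sub, PowerSeries.coeff_zero_mul_X, sub_zero, hz]
    linarith [hq 0, hB0 0]
  | succ n =>
    rw [mul_sub, mul_one, map_sub, PowerSeries.coeff_succ_mul_X, hs]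
    have e : r * PowerSeries.coeff n g + PowerSeries.coeff (n + 1) q - PowerSeries.coeff n g
        = PowerSeries.coeff (n + 1) q - (1 - r) * PowerSeries.coeff n g := by ring
    rw [e]
    have h1 := abs_sub (PowerSeries.coeff (n + 1) q) ((1 - r) * PowerSeries.coeff n g)
    rw [abs_mul, abs_of_nonneg (by linarith : (0:ℝ) ≤ 1 - r)] at h1
    linarith [hbound n, hB n.le_succ, hq (n + 1)]

/-- `|[t^n] (1 - t)^α (1 - r t)^(-β)| ≤ C (n + 1) ^ (β - α - 1)`, uniformly in `r`. -/
def UniformCoeffBound (α β : ℝ) : Prop :=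
  ∃ C : ℝ, ∀ r ∈ Set.Icc (0 : ℝ) 1, ∀ n : ℕ,
    |PowerSeries.coeff n (oneSubPow 1 α * oneSubPow r (-β))| ≤ C * (n + 1 : ℝ) ^ (β - α - 1)

/-- Both factors have nonnegative coefficients, and those of the second grow with `r`, so `r = 1` is
the worst case. -/
theorem uniformCoeffBound_of_nonpos {α β : ℝ} (hα : α ≤ 0) (hβ : 0 ≤ β) (h : 1 ≤ β - α) :
    UniformCoeffBound α β := by
  obtain ⟨C, hC⟩ := exists_oneSubCoeff_neg_le h
  refine ⟨C, fun r hr n => ?_⟩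
  refine le_trans ?_ (hC n)
  have h1 : oneSubCoeff (-(β - α)) n =
      PowerSeries.coeff n (oneSubPow 1 α * oneSubPow 1 (-β)) := by
    rw [← oneSubPow_add, coeff_oneSubPow]; simp [sub_eq_add_neg]
  rw [h1, PowerSeries.coeff_mul, PowerSeries.coeff_mul]
  simp only [coeff_oneSubPow, one_pow, one_mul]
  rw [abs_of_nonneg]
  · refine Finset.sum_le_sum fun p _ => ?_
    refine mul_le_mul_of_nonneg_left ?_ (oneSubCoeff_nonneg hα _)
    exact mul_le_of_le_one_left (oneSubCoeff_nonneg (by linarith) _) (pow_le_one₀ hr.1 hr.2)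
  · exact Finset.sum_nonneg fun p _ => mul_nonneg (oneSubCoeff_nonneg hα _)
      (mul_nonneg (pow_nonneg hr.1 _) (oneSubCoeff_nonneg (by linarith) _))

/-- Splitting off `(1 - t) / (1 - r t)` lowers `α` and `β` by one and keeps `β - α`; the condition
`1 ≤ β - α` makes the bound monotone. -/
theorem uniformCoeffBound_of_one_le (k : ℕ) : ∀ {α β : ℝ}, α ≤ k → 0 ≤ β → 1 ≤ β - α →
    UniformCoeffBound α β := by
  induction k with
  | zero => intro α β hα hβ h; exact uniformCoeffBound_of_nonpos (by simpa using hα) hβ h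
  | succ k ih =>
    intro α β hα hβ h
    rcases le_or_gt α 0 with h0 | h0
    · exact uniformCoeffBound_of_nonpos h0 hβ h
    push_cast at hα
    obtain ⟨C, hC⟩ := @ih (α - 1) (β - 1) (by linarith) (by linarith) (by linarith)
    refine ⟨2 * C, fun r hr n => ?_⟩
    have hC0 : 0 ≤ C := by simpa using (abs_nonneg _).trans (hC r hr 0)
    have e : oneSubPow 1 α * oneSubPow r (-β) = (oneSubPow 1 (α - 1) * oneSubPow r (-(β - 1))) *
        (oneSubPow 1 1 * oneSubPow r (-1)) := by
      rw [mul_mul_mul_comm, ← oneSubPow_add, ← oneSubPow_add]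
      congr 2 <;> ring
    have h2 : β - 1 - (α - 1) - 1 = β - α - 1 := by ring
    rw [h2] at hC
    rw [e, mul_assoc 2]
    refine abs_coeff_mul_oneSubPow_le hr _ (B := fun n : ℕ => C * (n + 1 : ℝ) ^ (β - α - 1))
      ?_ (hC r hr) n
    intro i j hij
    have : (i : ℝ) ≤ j := by exact_mod_cast hij
    have h3 : 0 ≤ β - α - 1 := by linarith
    dsimp only
    gcongr

/-- Differentiation gives products with exponents `(α - 1, β)` and `(α, β + 1)`, for which `β - α`
is larger by one; dividing by `n + 1` restores the exponent. -/
theorem uniformCoeffBound_of_one_sub_le (m : ℕ) : ∀ {α β : ℝ}, 0 ≤ β → 1 - m ≤ β - α →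
    UniformCoeffBound α β := by
  induction m with
  | zero =>
    intro α β hβ h
    exact uniformCoeffBound_of_one_le ⌈α⌉₊ (Nat.le_ceil α) hβ (by simpa using h)
  | succ m ih =>
    intro α β hβ h
    push_cast at h
    obtain ⟨C₁, h₁⟩ := @ih (α - 1) β hβ (by linarith)
    obtain ⟨C₂, h₂⟩ := @ih α (β + 1) (by linarith) (by linarith)
    rw [show β - (α - 1) - 1 = β - α by ring] at h₁
    rw [show β + 1 - α - 1 = β - α by ring] at h₂
    have hI : (0 : ℝ) ∈ Set.Icc (0 : ℝ) 1 := by simp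
    have hC₁ : 0 ≤ C₁ := by simpa using (abs_nonneg _).trans (h₁ 0 hI 0)
    have hC₂ : 0 ≤ C₂ := by simpa using (abs_nonneg _).trans (h₂ 0 hI 0)
    set D := |α| * C₁ + β * C₂ with hD
    have hD0 : 0 ≤ D := by positivity
    -- `κ` pays for replacing `n + 1` by `n + 2 ≤ 2 * (n + 1)`; the summand 1 below covers
    -- coefficient 0.
    set κ : ℝ := 2 ^ |β - α - 1| with hκ
    refine ⟨1 + D * κ, fun r hr n => ?_⟩
    cases n with
    | zero =>
      simp only [PowerSeries.coeff_mul, coeff_oneSubPow]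
      simp
      positivity
    | succ n =>
      have hd : PowerSeries.coeff n (PowerSeries.derivative (R := ℝ)
          (oneSubPow 1 α * oneSubPow r (-β))) =
          -α * PowerSeries.coeff n (oneSubPow 1 (α - 1) * oneSubPow r (-β)) +
          β * r * PowerSeries.coeff n (oneSubPow 1 α * oneSubPow r (-(β + 1))) := by
        rw [Derivation.leibniz, derivative_oneSubPow, derivative_oneSubPow]
        simp only [smul_eq_mul, mul_one, neg_neg, mul_smul_comm, map_add, PowerSeries.coeff_smul]
        rw [mul_comm (oneSubPow r (-β)), show -β - 1 = -(β + 1) by ring]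
        ring
      rw [PowerSeries.coeff_derivative] at hd
      have hn : (0 : ℝ) < n + 1 := by positivity
      have h3 : |PowerSeries.coeff (n + 1) (oneSubPow 1 α * oneSubPow r (-β))| * (n + 1 : ℝ) ≤
          D * (n + 1 : ℝ) ^ (β - α) := by
        rw [← abs_of_pos hn, ← abs_mul, hd, abs_of_pos hn]
        refine (abs_add_le _ _).trans ?_
        rw [abs_mul, abs_mul, abs_neg, abs_mul, abs_of_nonneg hβ, abs_of_nonneg hr.1, hD, add_mul,
          mul_assoc |α| C₁, mul_assoc β C₂]
        refine add_le_add (mul_le_mul_of_nonneg_left (h₁ r hr n) (abs_nonneg _)) ?_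
        rw [mul_assoc]
        refine mul_le_mul_of_nonneg_left ?_ hβ
        exact (mul_le_of_le_one_left (abs_nonneg _) hr.2).trans (h₂ r hr n)
      have h4 : |PowerSeries.coeff (n + 1) (oneSubPow 1 α * oneSubPow r (-β))| ≤
          D * (n + 1 : ℝ) ^ (β - α - 1) := by
        refine le_of_mul_le_mul_right (h3.trans_eq ?_) hn
        rw [mul_assoc, ← Real.rpow_add_one hn.ne', sub_add_cancel]
      have h5 : (n + 1 : ℝ) ^ (β - α - 1) ≤ κ * ((n + 1 : ℕ) + 1 : ℝ) ^ (β - α - 1) := by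
        rcases le_or_gt 0 (β - α - 1) with h0 | h0
        · have hk1 : 1 ≤ κ := Real.one_le_rpow (by norm_num) (abs_nonneg _)
          refine le_trans ?_ (le_mul_of_one_le_left (by positivity) hk1)
          gcongr
          linarith
        · have : κ * (2 : ℝ) ^ (β - α - 1) = 1 := by
            rw [hκ, abs_of_neg h0, ← Real.rpow_add (by norm_num)]; simp
          calc (n + 1 : ℝ) ^ (β - α - 1) = κ * (2 * (n + 1) : ℝ) ^ (β - α - 1) := by
                rw [Real.mul_rpow (by norm_num) hn.le, ← mul_assoc, this, one_mul]
            _ ≤ _ := by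
                refine mul_le_mul_of_nonneg_left ?_ (by positivity)
                refine Real.rpow_le_rpow_of_nonpos (by positivity) ?_ h0.le
                push_cast
                have : (0 : ℝ) ≤ n := n.cast_nonneg
                linarith
      calc _ ≤ D * (n + 1 : ℝ) ^ (β - α - 1) := h4
        _ ≤ D * (κ * ((n + 1 : ℕ) + 1 : ℝ) ^ (β - α - 1)) := by gcongr
        _ ≤ _ := by
          rw [← mul_assoc]
          gcongr
          linarith

theorem uniformCoeffBound (α : ℝ) {β : ℝ} (hβ : 0 ≤ β) : UniformCoeffBound α β :=
  uniformCoeffBound_of_one_sub_le ⌈1 - (β - α)⌉₊ hβ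
    (by linarith [Nat.le_ceil (1 - (β - α))])

theorem exists_abs_oneSubCoeff_le (s : ℝ) :
    ∃ C : ℝ, 0 ≤ C ∧ ∀ n : ℕ, |oneSubCoeff s n| ≤ C * (n + 1 : ℝ) ^ (-s - 1) := by
  obtain ⟨C, hC⟩ := uniformCoeffBound s le_rfl
  have h : ∀ n : ℕ, |oneSubCoeff s n| ≤ C * (n + 1 : ℝ) ^ (-s - 1) := by
    intro n
    have := hC 1 (by simp) n
    rwa [← oneSubPow_add, coeff_oneSubPow, one_pow, one_mul, neg_zero, add_zero, zero_sub] at this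
  exact ⟨C, by simpa using (abs_nonneg _).trans (h 0), h⟩

/-! ### Rearrangement for `r < 1` and passage to the limit -/

theorem summable_rpow_mul_geometric (s : ℝ) {r : ℝ} (hr0 : 0 < r) (hr : r < 1) :
    Summable fun n : ℕ => (n + 1 : ℝ) ^ s * r ^ n := by
  have h := summable_pow_mul_geometric_of_norm_lt_one (R := ℝ) ⌈s⌉₊
    (show ‖r‖ < 1 by rwa [Real.norm_of_nonneg hr0.le])
  have h2 := ((summable_nat_add_iff 1).2 h).mul_left r⁻¹
  refine h2.of_nonneg_of_le (fun n => by positivity) fun n => ?_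
  have h3 : (n + 1 : ℝ) ^ s ≤ (n + 1 : ℝ) ^ ⌈s⌉₊ := by
    rw [← Real.rpow_natCast]
    exact Real.rpow_le_rpow_of_exponent_le (by simp) (Nat.le_ceil s)
  calc (n + 1 : ℝ) ^ s * r ^ n ≤ (n + 1 : ℝ) ^ ⌈s⌉₊ * r ^ n := by gcongr
    _ = r⁻¹ * (((n + 1 : ℕ) : ℝ) ^ ⌈s⌉₊ * r ^ (n + 1)) := by
      push_cast; rw [pow_succ r]; field_simp

theorem summable_mul_of_abs_le {u α : ℕ → ℝ} {s C : ℝ} (hu : ∀ n, 0 ≤ u n)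
    (hsum : Summable fun n : ℕ => (n + 1 : ℝ) ^ s * u n)
    (hα : ∀ n : ℕ, |α n| ≤ C * (n + 1 : ℝ) ^ s) : Summable fun n => α n * u n := by
  refine Summable.of_norm_bounded (hsum.mul_left C) fun n => ?_
  rw [Real.norm_eq_abs, abs_mul, abs_of_nonneg (hu n), ← mul_assoc]
  exact mul_le_mul_of_nonneg_right (hα n) (hu n)

/-- From `n + j + 1 ≤ (n + 1) * (j + 1)`, the weight at `n` is at most `(j + 1) ^ (b + 1)` times the
weight at `n + j`; `r ^ j` absorbs the polynomial growth in `j`. -/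
theorem summable_prod_oneSubCoeff {a b : ℝ} {u : ℕ → ℝ} (hb : 0 < b) (hba : b < a)
    (hu : ∀ n, 0 ≤ u n) (hsum : Summable fun n : ℕ => (n + 1 : ℝ) ^ (-b - 1) * u n)
    {r : ℝ} (hr0 : 0 < r) (hr : r < 1) :
    Summable fun p : ℕ × ℕ =>
      (r ^ p.1 * oneSubCoeff (-(a - b)) p.1) * (oneSubCoeff a p.2 * u (p.2 + p.1)) := by
  obtain ⟨C, hC0, hC⟩ := exists_abs_oneSubCoeff_le a
  obtain ⟨D, hD0, hD⟩ := exists_abs_oneSubCoeff_le (-(a - b))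
  have hf : Summable fun j : ℕ => (C * D) * ((j + 1 : ℝ) ^ (a - b - 1 + (b + 1)) * r ^ j) :=
    (summable_rpow_mul_geometric _ hr0 hr).mul_left _
  have hfg := hf.mul_of_nonneg hsum (fun j => by positivity)
    (fun n => mul_nonneg (by positivity) (hu n))
  have hinj : Function.Injective fun p : ℕ × ℕ => (p.1, p.2 + p.1) := by
    rintro ⟨i, j⟩ ⟨k, l⟩ h
    simp only [Prod.mk.injEq] at h ⊢
    omega
  refine Summable.of_norm_bounded (hfg.comp_injective hinj) ?_
  rintro ⟨j, n⟩
  simp only [Function.comp_apply, Real.norm_eq_abs, abs_mul, abs_pow, abs_of_pos hr0,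
    abs_of_nonneg (hu _)]
  have h1 := hD j
  rw [neg_neg] at h1
  have h2 : |oneSubCoeff a n| ≤ C * ((j + 1 : ℝ) ^ (b + 1) * ((n + j : ℕ) + 1 : ℝ) ^ (-b - 1)) := by
    refine (hC n).trans (mul_le_mul_of_nonneg_left ?_ hC0)
    calc (n + 1 : ℝ) ^ (-a - 1) ≤ (n + 1 : ℝ) ^ (-b - 1) :=
          Real.rpow_le_rpow_of_exponent_le (by simp) (by linarith)
      _ = (j + 1 : ℝ) ^ (b + 1) * ((n + 1) * (j + 1) : ℝ) ^ (-b - 1) := by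
          rw [Real.mul_rpow (by positivity) (by positivity), mul_left_comm,
            ← Real.rpow_add (by positivity)]
          simp
      _ ≤ _ := by
          refine mul_le_mul_of_nonneg_left ?_ (by positivity)
          refine Real.rpow_le_rpow_of_nonpos (by positivity) ?_ (by linarith)
          have : (0 : ℝ) ≤ n * j := by positivity
          push_cast
          linarith
  have hpos : (0 : ℝ) < j + 1 := by positivity
  calc _ ≤ (r ^ j * (D * (j + 1 : ℝ) ^ (a - b - 1))) *
        ((C * ((j + 1 : ℝ) ^ (b + 1) * ((n + j : ℕ) + 1 : ℝ) ^ (-b - 1))) * u (n + j)) := by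
        have := hu (n + j)
        gcongr
    _ = _ := by
        rw [Real.rpow_add hpos (a - b - 1) (b + 1)]
        ring

theorem tsum_coeff_mul_nonneg {a b : ℝ} {u : ℕ → ℝ} (hb : 0 < b) (hba : b < a)
    (hu : ∀ n, 0 ≤ u n) (hsum : Summable fun n : ℕ => (n + 1 : ℝ) ^ (-b - 1) * u n)
    (hv : ∀ j, 0 ≤ ∑' n, oneSubCoeff a n * u (n + j))
    {r : ℝ} (hr0 : 0 < r) (hr : r < 1) :
    0 ≤ ∑' n, PowerSeries.coeff n (oneSubPow 1 a * oneSubPow r (-(a - b))) * u n := by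
  have hS := summable_prod_oneSubCoeff hb hba hu hsum hr0 hr
  have h1 : ∑' p : ℕ × ℕ,
      (r ^ p.1 * oneSubCoeff (-(a - b)) p.1) * (oneSubCoeff a p.2 * u (p.2 + p.1)) =
      ∑' j, (r ^ j * oneSubCoeff (-(a - b)) j) * ∑' n, oneSubCoeff a n * u (n + j) := by
    rw [hS.tsum_prod]
    simp_rw [tsum_mul_left]
  have h2 : ∑' p : ℕ × ℕ,
      (r ^ p.1 * oneSubCoeff (-(a - b)) p.1) * (oneSubCoeff a p.2 * u (p.2 + p.1)) =
      ∑' n, PowerSeries.coeff n (oneSubPow 1 a * oneSubPow r (-(a - b))) * u n := by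
    rw [← (Finset.HasAntidiagonal.sigmaAntidiagonalEquivProd (A := ℕ)).tsum_eq]
    refine (Summable.tsum_sigma' (fun n => (hasSum_fintype _).summable)
      ((Finset.HasAntidiagonal.sigmaAntidiagonalEquivProd (A := ℕ)).summable_iff.2 hS)).trans ?_
    refine tsum_congr fun n => ?_
    rw [tsum_fintype, Finset.univ_eq_attach, mul_comm (oneSubPow 1 a), PowerSeries.coeff_mul,
      Finset.sum_mul, ← Finset.sum_attach (Finset.HasAntidiagonal.antidiagonal n)]
    refine Finset.sum_congr rfl fun p _ => ?_
    have hp := Finset.HasAntidiagonal.mem_antidiagonal.1 p.2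
    simp only [Function.comp_apply,
      Finset.HasAntidiagonal.sigmaAntidiagonalEquivProd_apply, coeff_oneSubPow, one_pow, one_mul]
    rw [add_comm p.1.2, hp]
    ring
  rw [← h2, h1]
  exact tsum_nonneg fun j => mul_nonneg
    (mul_nonneg (pow_nonneg hr0.le _) (oneSubCoeff_nonneg (by linarith) _)) (hv j)

/-- If `u ≥ 0` is summable against `(n + 1) ^ (-b - 1)`, nonnegativity of all the fractional
differences of order `a > b` of `u` implies nonnegativity of the one of order `b`. -/
theorem tsum_oneSubCoeff_mul_nonneg {a b : ℝ} {u : ℕ → ℝ} (hb : 0 < b) (hba : b < a)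
    (hu : ∀ n, 0 ≤ u n) (hsum : Summable fun n : ℕ => (n + 1 : ℝ) ^ (-b - 1) * u n)
    (hv : ∀ j, 0 ≤ ∑' n, oneSubCoeff a n * u (n + j)) :
    0 ≤ ∑' n, oneSubCoeff b n * u n := by
  obtain ⟨C, hC⟩ := uniformCoeffBound a (sub_nonneg.2 hba.le)
  rw [show a - b - a - 1 = -b - 1 by ring] at hC
  have hI : ∀ᶠ r : ℝ in 𝓝[<] 1, r ∈ Set.Ioo (0 : ℝ) 1 := Ioo_mem_nhdsLT one_pos
  have hlim : Tendsto (fun r : ℝ =>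
      ∑' n, PowerSeries.coeff n (oneSubPow 1 a * oneSubPow r (-(a - b))) * u n) (𝓝[<] 1)
      (𝓝 (∑' n, oneSubCoeff b n * u n)) := by
    refine tendsto_tsum_of_dominated_convergence (hsum.mul_left C) (fun n => ?_) ?_
    · have hb' : oneSubCoeff b n =
          PowerSeries.coeff n (oneSubPow 1 a * oneSubPow 1 (-(a - b))) := by
        rw [← oneSubPow_add, coeff_oneSubPow]; simp
      rw [hb']
      refine Tendsto.mul_const _ (Tendsto.mono_left (Continuous.tendsto ?_ 1) nhdsWithin_le_nhds)
      simp only [PowerSeries.coeff_mul, coeff_oneSubPow]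
      fun_prop
    · filter_upwards [hI] with r hr n
      rw [Real.norm_eq_abs, abs_mul, abs_of_nonneg (hu n), ← mul_assoc]
      exact mul_le_mul_of_nonneg_right (hC r (Set.Ioo_subset_Icc_self hr) n) (hu n)
  refine ge_of_tendsto hlim ?_
  filter_upwards [hI] with r hr
  exact tsum_coeff_mul_nonneg hb hba hu hsum hv hr.1 hr.2

/-- The ratio of consecutive coefficients, `(n - b) / (n + 1)`, is nonnegative once `n ≥ b`. -/
theorem oneSubCoeff_sign (b : ℝ) :
    ∃ (N : ℕ) (σ : ℝ), ∀ n, N ≤ n → oneSubCoeff b n = σ * |oneSubCoeff b n| := by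
  obtain ⟨N, hN⟩ := exists_nat_ge b
  refine ⟨N, SignType.sign (oneSubCoeff b N), fun n hn => ?_⟩
  induction n, hn using Nat.le_induction with
  | base => exact (sign_mul_abs _).symm
  | succ n hn ih =>
    have h := oneSubCoeff_succ b n
    have hn' : (N : ℝ) ≤ n := by exact_mod_cast hn
    have hp : (0 : ℝ) < n + 1 := by positivity
    have h' : oneSubCoeff b (n + 1) = ((n - b) / (n + 1)) * oneSubCoeff b n := by
      field_simp; linarith
    have h0 : 0 ≤ (n - b) / (n + 1 : ℝ) := div_nonneg (by linarith) hp.le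
    rw [h', abs_mul, abs_of_nonneg h0]
    linear_combination ((n - b) / (n + 1)) * ih

/-! ### Operator series and their quadratic forms -/

section Hereditary

variable {H : Type*} [NormedAddCommGroup H] [InnerProductSpace ℂ H] [CompleteSpace H]

theorem hasHereditarySum_iff {α : ℕ → ℝ} {T S : H →L[ℂ] H} :
    HasHereditarySum α T S ↔
      ∀ x, Tendsto (fun N => hereditaryPartialSum α T N x) atTop (𝓝 (S x)) :=
  PointwiseConvergenceCLM.tendsto_iff_forall_tendsto

theorem inner_hereditaryPartialSum (α : ℕ → ℝ) (T : H →L[ℂ] H) (N : ℕ) (x : H) :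
    inner ℂ (hereditaryPartialSum α T N x) x =
      ((∑ n ∈ Finset.range N, α n * ‖(T ^ n) x‖ ^ 2 : ℝ) : ℂ) := by
  have hadj : ∀ n : ℕ, ContinuousLinearMap.adjoint T ^ n = ContinuousLinearMap.adjoint (T ^ n) := by
    intro n
    rw [← ContinuousLinearMap.star_eq_adjoint, ← ContinuousLinearMap.star_eq_adjoint, star_pow]
  have hterm : ∀ n : ℕ, inner ℂ ((ContinuousLinearMap.adjoint T ^ n * T ^ n) x) x =
      ((‖(T ^ n) x‖ ^ 2 : ℝ) : ℂ) := by
    intro n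
    rw [hadj]
    change inner ℂ (ContinuousLinearMap.adjoint (T ^ n) ((T ^ n) x)) x = _
    rw [ContinuousLinearMap.adjoint_inner_left, inner_self_eq_norm_sq_to_K]
    push_cast
    rfl
  simp only [hereditaryPartialSum, sum_apply, sum_inner, smul_apply, inner_smul_left, hterm,
    Complex.conj_ofReal, Complex.ofReal_sum, Complex.ofReal_mul]

theorem HasHereditarySum.tendsto_inner {α : ℕ → ℝ} {T S : H →L[ℂ] H}
    (h : HasHereditarySum α T S) (x : H) :
    Tendsto (fun N => ((∑ n ∈ Finset.range N, α n * ‖(T ^ n) x‖ ^ 2 : ℝ) : ℂ)) atTop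
      (𝓝 (inner ℂ (S x) x)) := by
  simp_rw [← inner_hereditaryPartialSum]
  exact (hasHereditarySum_iff.1 h x).inner tendsto_const_nhds

theorem HasHereditarySum.inner_eq_tsum {α : ℕ → ℝ} {T S : H →L[ℂ] H}
    (h : HasHereditarySum α T S) (x : H) (hs : Summable fun n => α n * ‖(T ^ n) x‖ ^ 2) :
    inner ℂ (S x) x = ((∑' n, α n * ‖(T ^ n) x‖ ^ 2 : ℝ) : ℂ) :=
  tendsto_nhds_unique (h.tendsto_inner x)
    ((Complex.continuous_ofReal.tendsto _).comp hs.hasSum.tendsto_sum_nat)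

theorem AbsHereditarySummable.summable {α : ℕ → ℝ} {T : H →L[ℂ] H}
    (h : AbsHereditarySummable α T) (x : H) :
    Summable fun n => |α n| * ‖(T ^ n) x‖ ^ 2 := by
  obtain ⟨S, hS⟩ := h
  have h1 := (Complex.continuous_re.tendsto _).comp (hS.tendsto_inner x)
  simp only [Function.comp_def, Complex.ofReal_re] at h1
  exact ((hasSum_iff_tendsto_nat_of_nonneg (fun n => by positivity) _).2 h1).summable

/-- Beyond `N` the series is `σ` times the series of absolute values, so strong convergence carries
over. -/
theorem AbsHereditarySummable.exists_hasHereditarySum {α : ℕ → ℝ} {T : H →L[ℂ] H}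
    (h : AbsHereditarySummable α T) {N : ℕ} {σ : ℝ} (hσ : ∀ n, N ≤ n → α n = σ * |α n|) :
    ∃ S, HasHereditarySum α T S := by
  obtain ⟨S, hS⟩ := h
  refine ⟨hereditaryPartialSum α T N +
    (σ : ℂ) • (S - hereditaryPartialSum (fun n => |α n|) T N), ?_⟩
  rw [hasHereditarySum_iff] at hS ⊢
  intro x
  have h1 : ∀ M, N ≤ M → hereditaryPartialSum α T M = hereditaryPartialSum α T N +
      (σ : ℂ) • (hereditaryPartialSum (fun n => |α n|) T M
        - hereditaryPartialSum (fun n => |α n|) T N) := by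
    intro M hM
    induction M, hM using Nat.le_induction with
    | base => simp
    | succ M hM ih =>
      have e : ∀ β : ℕ → ℝ, hereditaryPartialSum β T (M + 1) = hereditaryPartialSum β T M +
          (β M : ℂ) • (ContinuousLinearMap.adjoint T ^ M * T ^ M) := fun β =>
        Finset.sum_range_succ _ _
      rw [e, e, ih]
      have h2 : (α M : ℂ) = σ * (|α M| : ℝ) := by rw [← Complex.ofReal_mul, ← hσ M hM]
      rw [h2]
      module
  have h2 : Tendsto (fun M => hereditaryPartialSum α T N x +
      (σ : ℂ) • (hereditaryPartialSum (fun n => |α n|) T M x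
        - hereditaryPartialSum (fun n => |α n|) T N x)) atTop
      (𝓝 (hereditaryPartialSum α T N x +
        (σ : ℂ) • (S x - hereditaryPartialSum (fun n => |α n|) T N x))) :=
    (((hS x).sub_const _).const_smul _).const_add _
  refine Tendsto.congr' ?_ h2
  filter_upwards [eventually_ge_atTop N] with M hM
  rw [h1 M hM]
  simp

end Hereditary

theorem theorem1p5 {H : Type*} [NormedAddCommGroup H] [InnerProductSpace ℂ H] [CompleteSpace H]
    (a b : ℝ) (hb : 0 < b) (hba : b < a) (hbint : ∀ m : ℤ, b ≠ (m : ℝ))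
    (T : H →L[ℂ] H) (hT : IsRealContraction a T)
    (hTb : AbsHereditarySummable (cesaroNumber (-b)) T) :
    IsRealContraction b T := by
  have hces : ∀ s, cesaroNumber (-s) = oneSubCoeff s := fun s => funext (cesaroNumber_neg s)
  obtain ⟨S, hS, hSpos⟩ := hT
  rw [hces] at hS hTb
  obtain ⟨N, σ, hσ⟩ := oneSubCoeff_sign b
  obtain ⟨R, hR⟩ := hTb.exists_hasHereditarySum hσ
  refine ⟨R, by rwa [hces], (ContinuousLinearMap.isPositive_iff_complex R).2 fun x => ?_⟩
  obtain ⟨C, hC⟩ := exists_rpow_le_mul_abs_oneSubCoeff hb hbint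
  obtain ⟨D, hD0, hD⟩ := exists_abs_oneSubCoeff_le a
  have hsum : ∀ y : H, Summable fun n : ℕ => (n + 1 : ℝ) ^ (-b - 1) * ‖(T ^ n) y‖ ^ 2 := by
    intro y
    refine ((hTb.summable y).mul_left C).of_nonneg_of_le (fun n => by positivity) fun n => ?_
    rw [← mul_assoc]
    exact mul_le_mul_of_nonneg_right (hC n) (by positivity)
  have hDb : ∀ n : ℕ, |oneSubCoeff a n| ≤ D * (n + 1 : ℝ) ^ (-b - 1) := fun n =>
    (hD n).trans (mul_le_mul_of_nonneg_left
      (Real.rpow_le_rpow_of_exponent_le (by simp) (by linarith)) hD0)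
  -- The sum is the quadratic form of `S` at `T ^ j x`; absolute convergence, from `a > b`,
  -- identifies the strong limit with the `tsum`.
  have hv : ∀ j, 0 ≤ ∑' n, oneSubCoeff a n * ‖(T ^ (n + j)) x‖ ^ 2 := by
    intro j
    have h1 := hS.inner_eq_tsum ((T ^ j) x)
      (summable_mul_of_abs_le (fun n => by positivity) (hsum ((T ^ j) x)) hDb)
    have h2 := hSpos.inner_nonneg_left ((T ^ j) x)
    rw [h1, Complex.zero_le_real] at h2
    simp only [pow_add]
    exact h2
  have hpos := tsum_oneSubCoeff_mul_nonneg hb hba (fun n => by positivity) (hsum x) hv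
  have hsb : Summable fun n => oneSubCoeff b n * ‖(T ^ n) x‖ ^ 2 := by
    refine Summable.of_norm_bounded (hTb.summable x) fun n => ?_
    rw [Real.norm_eq_abs, abs_mul, abs_of_nonneg (by positivity : 0 ≤ ‖(T ^ n) x‖ ^ 2)]
  rw [hR.inner_eq_tsum x hsb]
  exact ⟨by simp, by simpa using hpos⟩
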